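/- For positive integers $m<n$, let $K_G(n\mapsto m)$ denote the smallest real number $K$ such that for every positive integer $r$ and every real $r\times r$ matrix $M=(M_{ij})$, $$\max_{a_1,\dots,a_r,\,b_1,\dots,b_r\in S^{n-1}}\ \sum_{i,j=1}^r M_{ij}\,a_i\cdot b_j\ \le\ K\max_{a'_1,\dots,a'_r,\,b'_1,\dots,b'_r\in S^{m-1}}\ \sum_{i,j=1}^r M_{ij}\,a'_i\cdot b'_j ,$$ where $S^{k-1}$ is the Euclidean unit sphere of $\mathbb{R}^k$ and $\cdot$ is the Euclidean inner product (such a smallest number exists). Then for all positive integers $m<n$, $$K_G(n\mapsto m)\ \ge\ \frac mn\left(\frac{\Gamma(\frac m2)}{\Gamma(\frac{m+1}2)}\cdot\frac{\Gamma(\frac{n+1}2)}{\Gamma(\frac n2)}\right)^2 .$$ Moreover, the right-hand side equals $1+\frac1{2m}-\frac1{2n}+O\!\left(\frac1{m^2}\right)$ uniformly in $n$; that is, there is an absolute constant $C$ such that for all positive integers $m<n$, $$\left|\frac mn\left(\frac{\Gamma(\frac m2)}{\Gamma(\frac{m+1}2)}\cdot\frac{\Gamma(\frac{n+1}2)}{\Gamma(\frac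 n2)}\right)^2-\left(1+\frac1{2m}-\frac1{2n}\right)\right|\le\frac C{m^2}.$$ -/

import Mathlib

/-- The unit sphere of `ℝ^n` with its Euclidean norm. -/
abbrev UnitVec (n : ℕ) : Type :=
  Metric.sphere (0 : EuclideanSpace ℝ (Fin n)) 1

/-- The maximum of `∑ i j, M i j * ⟨a i, b j⟩` over all sequences `a`, `b` of `n`-dimensional real
unit vectors. For `0 < n` it is a supremum of a continuous function on a nonempty compact space,
hence an attained maximum. -/
noncomputable def maxVal (n : ℕ) {r : ℕ} (M : Matrix (Fin r) (Fin r) ℝ) : ℝ :=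
  ⨆ p : (Fin r → UnitVec n) × (Fin r → UnitVec n),
    ∑ i, ∑ j, M i j *
      inner ℝ (p.1 i : EuclideanSpace ℝ (Fin n)) (p.2 j : EuclideanSpace ℝ (Fin n))

/-- The real numbers `K` for which the generalized Grothendieck inequality, from dimension `n` to
dimension `m`, holds for all real square matrices. -/
def grothendieckBounds (n m : ℕ) : Set ℝ :=
  {K : ℝ | ∀ r : ℕ, 0 < r → ∀ M : Matrix (Fin r) (Fin r) ℝ, maxVal n M ≤ K * maxVal m M}

/-- The generalized Grothendieck constant `K_G(n ↦ m)`. -/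
noncomputable def grothendieckConst (n m : ℕ) : ℝ :=
  sInf (grothendieckBounds n m)

/-! The lower bound comes from one test kernel: rows and columns are indexed by standard Gaussian
vectors `x`, `y` of `ℝ^n`, with entries `⟨x, y⟩`. For `a = b` its bilinear value is the squared
Hilbert–Schmidt norm of `E[x ⊗ a(x)]`. In dimension `n`, the choice `a(x) = x / ‖x‖` gives a matrix
of trace `E‖x‖`, hence a value at least `(E‖x‖)² / n`. In dimension `m`, duality bounds the value by
`B²`, where `B` is the largest `E‖W x‖` over linear `W : ℝ^n → ℝ^m` of Hilbert–Schmidt norm one;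
`integral_norm_apply_stdGaussian_le` gives `B ≤ E‖h‖ / √m` for `h` Gaussian in `ℝ^m`. Since `E‖x‖ =
√2 Γ((n+1)/2) / Γ(n/2)`, the quotient is the stated bound. Matrices being finite,
`sq_sum_mul_norm_div_le` treats finitely many weighted points and `sq_integral_norm_sub_div_le`
passes to the Gaussian by `L¹` approximation. The asymptotics follow from two-sided bounds on
`Γ((k+1)/2) / Γ(k/2)`. -/

/-! ### Admissible constants and the existence of the smallest one. -/

lemma UnitVec.norm_coe {n : ℕ} (u : UnitVec n) : ‖(u : EuclideanSpace ℝ (Fin n))‖ = 1 := by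
  simp

lemma exists_unitVec_inner_eq_norm {n : ℕ} (hn : 0 < n) (v : EuclideanSpace ℝ (Fin n)) :
    ∃ u : UnitVec n, inner ℝ (u : EuclideanSpace ℝ (Fin n)) v = ‖v‖ := by
  by_cases hv : v = 0
  · refine ⟨⟨EuclideanSpace.single ⟨0, hn⟩ 1, by simp⟩, by simp [hv]⟩
  · have hv' : ‖v‖ ≠ 0 := norm_ne_zero_iff.mpr hv
    refine ⟨⟨‖v‖⁻¹ • v, by simp [norm_smul, hv']⟩, ?_⟩
    simp only [inner_smul_left, real_inner_self_eq_norm_sq, map_inv₀, conj_trivial]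
    field_simp

lemma UnitVec.nonempty {n : ℕ} (hn : 0 < n) : Nonempty (UnitVec n) :=
  ⟨(exists_unitVec_inner_eq_norm hn 0).choose⟩

lemma bddAbove_bilinear_value (n : ℕ) {r : ℕ} (M : Matrix (Fin r) (Fin r) ℝ) :
    BddAbove (Set.range fun p : (Fin r → UnitVec n) × (Fin r → UnitVec n) =>
      ∑ i, ∑ j, M i j *
        inner ℝ (p.1 i : EuclideanSpace ℝ (Fin n)) (p.2 j : EuclideanSpace ℝ (Fin n))) := by
  refine ⟨∑ i, ∑ j, |M i j|, ?_⟩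
  rintro _ ⟨p, rfl⟩
  refine Finset.sum_le_sum fun i _ => Finset.sum_le_sum fun j _ => ?_
  refine (le_abs_self _).trans ?_
  rw [abs_mul]
  refine mul_le_of_le_one_right (abs_nonneg _) ?_
  have := abs_real_inner_le_norm (p.1 i : EuclideanSpace ℝ (Fin n)) (p.2 j)
  simpa [UnitVec.norm_coe] using this

lemma le_maxVal {n r : ℕ} (M : Matrix (Fin r) (Fin r) ℝ) (a b : Fin r → UnitVec n) :
    ∑ i, ∑ j, M i j *
      inner ℝ (a i : EuclideanSpace ℝ (Fin n)) (b j : EuclideanSpace ℝ (Fin n)) ≤ maxVal n M :=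
  le_ciSup (bddAbove_bilinear_value n M) (a, b)

lemma maxVal_le {n r : ℕ} (hn : 0 < n) {M : Matrix (Fin r) (Fin r) ℝ} {B : ℝ}
    (h : ∀ a b : Fin r → UnitVec n, ∑ i, ∑ j, M i j *
      inner ℝ (a i : EuclideanSpace ℝ (Fin n)) (b j : EuclideanSpace ℝ (Fin n)) ≤ B) :
    maxVal n M ≤ B := by
  have := UnitVec.nonempty hn
  exact ciSup_le fun p => h p.1 p.2

/-- Vectors of the unit ball do no better than unit vectors. -/
lemma sum_mul_inner_le_maxVal {m r : ℕ} (hm : 0 < m) (M : Matrix (Fin r) (Fin r) ℝ)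
    (x y : Fin r → EuclideanSpace ℝ (Fin m)) (hx : ∀ i, ‖x i‖ ≤ 1) (hy : ∀ i, ‖y i‖ ≤ 1) :
    ∑ i, ∑ j, M i j * inner ℝ (x i) (y j) ≤ maxVal m M := by
  -- Alternating optimisation: `a` is optimal against `y`, then `b` is optimal against `a`.
  choose a ha using fun i => exists_unitVec_inner_eq_norm hm (∑ j, M i j • y j)
  choose b hb using fun j =>
    exists_unitVec_inner_eq_norm hm (∑ i, M i j • (a i : EuclideanSpace ℝ (Fin m)))
  calc ∑ i, ∑ j, M i j * inner ℝ (x i) (y j)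
      = ∑ i, inner ℝ (x i) (∑ j, M i j • y j) := by
        simp only [inner_sum, inner_smul_right]
    _ ≤ ∑ i, inner ℝ (a i : EuclideanSpace ℝ (Fin m)) (∑ j, M i j • y j) := by
        refine Finset.sum_le_sum fun i _ => ?_
        rw [ha]
        exact (real_inner_le_norm _ _).trans (mul_le_of_le_one_left (norm_nonneg _) (hx i))
    _ = ∑ j, inner ℝ (y j) (∑ i, M i j • (a i : EuclideanSpace ℝ (Fin m))) := by
        simp only [inner_sum, inner_smul_right]
        rw [Finset.sum_comm]
        simp only [real_inner_comm]
    _ ≤ ∑ j, inner ℝ (b j : EuclideanSpace ℝ (Fin m))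
          (∑ i, M i j • (a i : EuclideanSpace ℝ (Fin m))) := by
        refine Finset.sum_le_sum fun j _ => ?_
        rw [hb]
        exact (real_inner_le_norm _ _).trans (mul_le_of_le_one_left (norm_nonneg _) (hy j))
    _ = ∑ i, ∑ j, M i j * inner ℝ (a i : EuclideanSpace ℝ (Fin m)) (b j) := by
        simp only [inner_sum, inner_smul_right]
        rw [Finset.sum_comm]
        simp only [real_inner_comm]
    _ ≤ maxVal m M := le_maxVal M a b

/-- The inner product splits over `n` coordinates, each a product of scalars in `[-1, 1]`, that is,
of ball vectors on one line. The crude constant `n` makes the infimum one over a nonempty set. -/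
lemma natCast_mem_grothendieckBounds {m n : ℕ} (hm : 0 < m) (hn : 0 < n) :
    (n : ℝ) ∈ grothendieckBounds n m := by
  intro r _ M
  refine maxVal_le hn fun a b => ?_
  let e : EuclideanSpace ℝ (Fin m) := EuclideanSpace.single ⟨0, hm⟩ 1
  have he : ‖e‖ = 1 := by simp [e]
  have key : ∀ k : Fin n, ∑ i, ∑ j, M i j *
      inner ℝ ((a i : EuclideanSpace ℝ (Fin n)) k • e) ((b j : EuclideanSpace ℝ (Fin n)) k • e)
      ≤ maxVal m M := by
    intro k
    have hc : ∀ u : UnitVec n, ‖(u : EuclideanSpace ℝ (Fin n)) k • e‖ ≤ 1 := fun u => by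
      rw [norm_smul, he, mul_one]
      exact (PiLp.norm_apply_le _ k).trans (UnitVec.norm_coe u).le
    exact sum_mul_inner_le_maxVal hm M _ _ (fun i => hc _) (fun i => hc _)
  calc ∑ i, ∑ j, M i j *
        inner ℝ (a i : EuclideanSpace ℝ (Fin n)) (b j : EuclideanSpace ℝ (Fin n))
      = ∑ k : Fin n, ∑ i, ∑ j, M i j * inner ℝ ((a i : EuclideanSpace ℝ (Fin n)) k • e)
          ((b j : EuclideanSpace ℝ (Fin n)) k • e) := by
        rw [eq_comm, Finset.sum_comm]
        refine Finset.sum_congr rfl fun i _ => ?_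
        rw [Finset.sum_comm]
        refine Finset.sum_congr rfl fun j _ => ?_
        rw [← Finset.mul_sum]
        simp [inner_smul_left, inner_smul_right, he, PiLp.inner_apply, mul_comm]
    _ ≤ ∑ _k : Fin n, maxVal m M := Finset.sum_le_sum fun k _ => key k
    _ = n * maxVal m M := by simp

/-- The `1 × 1` identity matrix has value 1 in every positive dimension. -/
lemma one_le_of_mem_grothendieckBounds {m n : ℕ} (hm : 0 < m) (hn : 0 < n) {K : ℝ}
    (hK : K ∈ grothendieckBounds n m) : 1 ≤ K := by
  have h1 : ∀ k : ℕ, 0 < k → maxVal k (1 : Matrix (Fin 1) (Fin 1) ℝ) = 1 := by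
    intro k hk
    refine le_antisymm (maxVal_le hk fun a b => ?_) ?_
    · have := real_inner_le_norm (a 0 : EuclideanSpace ℝ (Fin k)) (b 0)
      simpa [UnitVec.norm_coe] using this
    · obtain ⟨u⟩ := UnitVec.nonempty hk
      have := le_maxVal (1 : Matrix (Fin 1) (Fin 1) ℝ) (fun _ => u) (fun _ => u)
      simpa [UnitVec.norm_coe] using this
  have := hK 1 one_pos 1
  rwa [h1 n hn, h1 m hm, mul_one] at this

lemma isLeast_grothendieckConst {m n : ℕ} (hm : 0 < m) (hn : 0 < n) :
    IsLeast (grothendieckBounds n m) (grothendieckConst n m) := by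
  have hbdd : BddBelow (grothendieckBounds n m) :=
    ⟨1, fun K hK => one_le_of_mem_grothendieckBounds hm hn hK⟩
  refine ⟨IsClosed.csInf_mem ?_ ⟨n, natCast_mem_grothendieckBounds hm hn⟩ hbdd,
    fun K hK => csInf_le hbdd hK⟩
  simp only [grothendieckBounds, Set.ofPred_forall]
  refine isClosed_iInter fun r => isClosed_iInter fun _ => isClosed_iInter fun M => ?_
  exact isClosed_le continuous_const (continuous_id.mul continuous_const)

/-! ### The test matrix. -/

/-- Testing the Grothendieck inequality on the weighted Gram matrix `p i * p j * ⟨x i, x j⟩`. -/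
lemma sq_sum_mul_norm_div_le {m n r : ℕ} (hm : 0 < m) (hn : 0 < n) (hr : 0 < r) {K : ℝ}
    (hK : K ∈ grothendieckBounds n m) (p : Fin r → ℝ) (hp : ∀ i, 0 ≤ p i)
    (x : Fin r → EuclideanSpace ℝ (Fin n)) {B : ℝ}
    (hB : ∀ w : Fin n → EuclideanSpace ℝ (Fin m),
      ∑ i, p i * ‖∑ k, x i k • w k‖ ≤ B * √(∑ k, ‖w k‖ ^ 2)) :
    (∑ i, p i * ‖x i‖) ^ 2 / n ≤ K * B ^ 2 := by
  let M : Matrix (Fin r) (Fin r) ℝ := fun i j => p i * p j * inner ℝ (x i) (x j)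
  have hM : ∀ {l : ℕ} (a b : Fin r → UnitVec l), ∑ i, ∑ j, M i j *
      inner ℝ (a i : EuclideanSpace ℝ (Fin l)) (b j : EuclideanSpace ℝ (Fin l)) =
      ∑ k, inner ℝ (∑ i, (p i * x i k) • (a i : EuclideanSpace ℝ (Fin l)))
        (∑ i, (p i * x i k) • (b i : EuclideanSpace ℝ (Fin l))) := by
    intro l a b
    simp only [M, sum_inner, inner_sum, inner_smul_left, inner_smul_right, conj_trivial]
    rw [Finset.sum_comm, eq_comm, Finset.sum_comm]
    refine Finset.sum_congr rfl fun j _ => ?_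
    simp only [Finset.mul_sum]
    rw [Finset.sum_comm]
    refine Finset.sum_congr rfl fun i _ => ?_
    rw [PiLp.inner_apply (x i) (x j), Finset.mul_sum, Finset.sum_mul]
    refine Finset.sum_congr rfl fun k _ => ?_
    simp only [RCLike.inner_apply, conj_trivial]
    ring
  have hup : maxVal m M ≤ B ^ 2 := by
    have hF : ∀ a : Fin r → UnitVec m,
        ∑ k, ‖∑ i, (p i * x i k) • (a i : EuclideanSpace ℝ (Fin m))‖ ^ 2 ≤ B ^ 2 := by
      intro a
      set A : Fin n → EuclideanSpace ℝ (Fin m) :=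
        fun k => ∑ i, (p i * x i k) • (a i : EuclideanSpace ℝ (Fin m)) with hA
      have h0 : 0 ≤ ∑ k, ‖A k‖ ^ 2 := Finset.sum_nonneg fun k _ => sq_nonneg _
      -- Self-bounding: pairing `A` with itself and using `hB` at `w = A` bounds the sum by `B`
      -- times its own square root.
      have h1 : ∑ k, ‖A k‖ ^ 2 ≤ B * √(∑ k, ‖A k‖ ^ 2) := by
        calc ∑ k, ‖A k‖ ^ 2
            = ∑ k, ∑ i, (p i * x i k) * inner ℝ (a i : EuclideanSpace ℝ (Fin m)) (A k) := by
              refine Finset.sum_congr rfl fun k _ => ?_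
              rw [← real_inner_self_eq_norm_sq]
              nth_rewrite 1 [hA]
              simp only [sum_inner, inner_smul_left, conj_trivial]
          _ = ∑ i, p i * inner ℝ (a i : EuclideanSpace ℝ (Fin m)) (∑ k, x i k • A k) := by
              rw [Finset.sum_comm]
              simp only [inner_sum, inner_smul_right, Finset.mul_sum, mul_assoc]
          _ ≤ ∑ i, p i * ‖∑ k, x i k • A k‖ := by
              refine Finset.sum_le_sum fun i _ => mul_le_mul_of_nonneg_left ?_ (hp i)
              have := real_inner_le_norm (a i : EuclideanSpace ℝ (Fin m)) (∑ k, x i k • A k)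
              rwa [UnitVec.norm_coe, one_mul] at this
          _ ≤ _ := hB A
      have h2 := Real.sq_sqrt h0
      have h3 := Real.sqrt_nonneg (∑ k, ‖A k‖ ^ 2)
      change ∑ k, ‖A k‖ ^ 2 ≤ B ^ 2
      nlinarith [sq_nonneg (B - √(∑ k, ‖A k‖ ^ 2))]
    refine maxVal_le hm fun a b => ?_
    rw [hM]
    have : ∀ u v : EuclideanSpace ℝ (Fin m), inner ℝ u v ≤ (‖u‖ ^ 2 + ‖v‖ ^ 2) / 2 := fun u v => by
      nlinarith [real_inner_le_norm u v, sq_nonneg (‖u‖ - ‖v‖)]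
    refine (Finset.sum_le_sum fun k _ => this _ _).trans ?_
    rw [← Finset.sum_div, Finset.sum_add_distrib]
    linarith [hF a, hF b]
  have hlow : (∑ i, p i * ‖x i‖) ^ 2 / n ≤ maxVal n M := by
    choose u hu using fun i => exists_unitVec_inner_eq_norm hn (x i)
    refine le_trans ?_ (le_maxVal M u u)
    rw [hM, div_le_iff₀ (by positivity)]
    -- The left side is the trace of `∑ p i • (x i ⊗ u i)`; Cauchy–Schwarz on its `n` diagonal
    -- entries, each bounded by the norm of its row, finishes.
    have htr : ∑ i, p i * ‖x i‖ =
        ∑ k, (∑ i, (p i * x i k) • (u i : EuclideanSpace ℝ (Fin n))) k := by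
      simp only [← hu, PiLp.inner_apply, Finset.mul_sum]
      rw [Finset.sum_comm]
      refine Finset.sum_congr rfl fun k _ => ?_
      simp [WithLp.ofLp_sum, mul_assoc]
    rw [htr]
    refine (sq_sum_le_card_mul_sum_sq).trans ?_
    rw [mul_comm]
    simp only [Finset.card_univ, Fintype.card_fin]
    refine mul_le_mul_of_nonneg_right (Finset.sum_le_sum fun k _ => ?_) (by positivity)
    rw [real_inner_self_eq_norm_sq, sq_le_sq, abs_norm, ← Real.norm_eq_abs]
    exact PiLp.norm_apply_le _ k
  have hK0 : 0 ≤ K := zero_le_one.trans (one_le_of_mem_grothendieckBounds hm hn hK)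
  exact hlow.trans ((hK r hr M).trans (mul_le_mul_of_nonneg_left hup hK0))

/-! ### Gaussian integrals and the mean norm. -/

open MeasureTheory ProbabilityTheory in
lemma map_inner_stdGaussian {E : Type*} [NormedAddCommGroup E] [InnerProductSpace ℝ E]
    [FiniteDimensional ℝ E] [MeasurableSpace E] [BorelSpace E] (v : E) :
    (stdGaussian E).map (fun x => inner ℝ v x) = gaussianReal 0 (‖v‖ ^ 2).toNNReal := by
  have h := IsGaussian.map_eq_gaussianReal (μ := stdGaussian E) (innerSL ℝ v)
  rw [integral_strongDual_stdGaussian, variance_dual_stdGaussian, innerSL_apply_norm] at h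
  exact h

open MeasureTheory ProbabilityTheory in
lemma integral_abs_inner_stdGaussian {E : Type*} [NormedAddCommGroup E] [InnerProductSpace ℝ E]
    [FiniteDimensional ℝ E] [MeasurableSpace E] [BorelSpace E] (v : E) :
    ∫ x, |inner ℝ v x| ∂(stdGaussian E) = ‖v‖ * ∫ t, |t| ∂(gaussianReal 0 1) := by
  have h : (gaussianReal 0 1).map (‖v‖ * ·) = gaussianReal 0 (‖v‖ ^ 2).toNNReal := by
    rw [gaussianReal_map_const_mul]
    congr 1
    · simp
    · ext; simp
  have h1 : ∫ x, |inner ℝ v x| ∂(stdGaussian E) =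
      ∫ t, |t| ∂((stdGaussian E).map (fun x => inner ℝ v x)) := by
    rw [integral_map (by fun_prop) (by fun_prop)]
  rw [h1, map_inner_stdGaussian, ← h, integral_map (by fun_prop) (by fun_prop),
    ← integral_const_mul]
  simp [abs_mul]

open MeasureTheory ProbabilityTheory in
lemma integral_abs_gaussianReal_pos : 0 < ∫ t, |t| ∂(gaussianReal 0 1) := by
  have hint : Integrable (fun t : ℝ => |t|) (gaussianReal 0 1) :=
    (IsGaussian.integrable_id (μ := gaussianReal 0 1)).abs
  rw [integral_pos_iff_support_of_nonneg (fun t => abs_nonneg t) hint]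
  have : Function.support (fun t : ℝ => |t|) = {0}ᶜ := by ext; simp
  have hn : NullSingletonClass (gaussianReal 0 1) := nullSingletonClass_gaussianReal one_ne_zero
  rw [this, prob_compl_eq_one_sub (measurableSet_singleton 0), measure_singleton]
  simp

-- Both measures are finite and have the same characteristic function.
open MeasureTheory ProbabilityTheory in
lemma stdGaussian_eq_withDensity (E : Type*) [NormedAddCommGroup E] [InnerProductSpace ℝ E]
    [FiniteDimensional ℝ E] [MeasurableSpace E] [BorelSpace E] :
    stdGaussian E = volume.withDensity (fun x : E => ENNReal.ofReal
      ((2 * Real.pi) ^ (-(Module.finrank ℝ E / 2 : ℝ)) * Real.exp (-(1 / 2) * ‖x‖ ^ 2))) := by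
  have hint : Integrable (fun x : E => Real.exp (-(1 / 2) * ‖x‖ ^ 2)) := by
    -- A non-integrable function would have integral 0, against the positive Gaussian value.
    by_contra h
    have h1 := GaussianFourier.integral_rexp_neg_mul_sq_norm (V := E) (b := 1 / 2) (by norm_num)
    rw [integral_undef h] at h1
    exact absurd h1.symm (by positivity)
  have hfin := isFiniteMeasure_withDensity_ofReal (hint.const_mul
    ((2 * Real.pi) ^ (-(Module.finrank ℝ E / 2 : ℝ)))).2
  refine Measure.ext_of_charFun ?_
  ext t
  rw [charFun_stdGaussian, charFun_apply, integral_withDensity_eq_integral_toReal_smul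
    (by fun_prop) (by simp)]
  have h := GaussianFourier.integral_cexp_neg_mul_sq_norm_add (V := E) (b := 1 / 2) (by simp)
    Complex.I t
  have h2 : ∀ x : E, (ENNReal.ofReal ((2 * Real.pi) ^ (-(Module.finrank ℝ E / 2 : ℝ)) *
      Real.exp (-(1 / 2) * ‖x‖ ^ 2))).toReal • Complex.exp (inner ℝ x t * Complex.I) =
      ((2 * Real.pi : ℂ) ^ (-(Module.finrank ℝ E / 2 : ℂ))) *
        Complex.exp (-(1 / 2) * ‖x‖ ^ 2 + Complex.I * inner ℝ t x) := by
    intro x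
    rw [ENNReal.toReal_ofReal (by positivity), Complex.real_smul, Complex.exp_add,
      real_inner_comm, Complex.ofReal_mul, Complex.ofReal_cpow (by positivity)]
    push_cast
    ring_nf
  simp_rw [h2]
  rw [integral_const_mul, h, ← mul_assoc, ← one_mul (Complex.exp _)]
  congr 1
  · rw [show (Real.pi : ℂ) / (1 / 2) = 2 * Real.pi by ring, ← Complex.cpow_add _ _ (by simp)]
    simp
  · congr 1
    rw [Complex.I_sq]
    ring

-- Polar coordinates. The constant `c` stays unspecified, as total mass one determines it later.
open MeasureTheory ProbabilityTheory in
lemma integral_fun_norm_stdGaussian (E : Type*) [NormedAddCommGroup E] [InnerProductSpace ℝ E]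
    [FiniteDimensional ℝ E] [MeasurableSpace E] [BorelSpace E] [Nontrivial E] :
    ∃ c : ℝ, ∀ f : ℝ → ℝ, ∫ x, f ‖x‖ ∂(stdGaussian E) =
      c * ∫ y in Set.Ioi (0 : ℝ), y ^ (Module.finrank ℝ E - 1) *
        (Real.exp (-(1 / 2) * y ^ 2) * f y) := by
  set a : ℝ := (2 * Real.pi) ^ (-(Module.finrank ℝ E / 2 : ℝ)) with ha
  have ha0 : 0 ≤ a := by positivity
  refine ⟨a * (Module.finrank ℝ E * (volume : Measure E).real (Metric.ball 0 1)), fun f => ?_⟩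
  rw [stdGaussian_eq_withDensity, integral_withDensity_eq_integral_toReal_smul
    (by fun_prop) (by simp)]
  have h := integral_fun_norm_addHaar (volume : Measure E)
    (fun y => Real.exp (-(1 / 2) * y ^ 2) * f y)
  simp only [nsmul_eq_mul, smul_eq_mul] at h
  rw [mul_assoc, mul_assoc, ← h, ← integral_const_mul]
  refine integral_congr_ae (Filter.Eventually.of_forall fun x => ?_)
  simp only [smul_eq_mul]
  rw [ENNReal.toReal_ofReal (by positivity)]
  ring

open MeasureTheory ProbabilityTheory in
lemma integral_norm_stdGaussian {n : ℕ} (hn : 0 < n) :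
    ∫ x, ‖x‖ ∂(stdGaussian (EuclideanSpace ℝ (Fin n))) =
      √2 * (Real.Gamma (((n : ℝ) + 1) / 2) / Real.Gamma ((n : ℝ) / 2)) := by
  have : Nonempty (Fin n) := ⟨⟨0, hn⟩⟩
  obtain ⟨c, hc⟩ := integral_fun_norm_stdGaussian (EuclideanSpace ℝ (Fin n))
  have hG : ∀ q : ℝ, -1 < q → ∫ y in Set.Ioi (0 : ℝ), y ^ q * Real.exp (-(1 / 2) * y ^ (2 : ℝ)) =
      (1 / 2) ^ (-(q + 1) / 2) * (1 / 2) * Real.Gamma ((q + 1) / 2) :=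
    fun q hq => integral_rpow_mul_exp_neg_mul_rpow two_pos hq (by norm_num)
  have h1 : ∫ y in Set.Ioi (0 : ℝ), y ^ (n - 1) * (Real.exp (-(1 / 2) * y ^ 2) * 1) =
      (1 / 2) ^ (-(n : ℝ) / 2) * (1 / 2) * Real.Gamma (n / 2) := by
    have hn1 : ((n - 1 : ℕ) : ℝ) = n - 1 := by rw [Nat.cast_sub hn]; simp
    have hq := hG ((n - 1 : ℕ) : ℝ) (by linarith [(Nat.cast_nonneg (n - 1) : (0 : ℝ) ≤ _)])
    rw [hn1, sub_add_cancel, ← hn1] at hq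
    simpa [Real.rpow_natCast] using hq
  have h2 : ∫ y in Set.Ioi (0 : ℝ), y ^ (n - 1) * (Real.exp (-(1 / 2) * y ^ 2) * y) =
      (1 / 2) ^ (-((n : ℝ) + 1) / 2) * (1 / 2) * Real.Gamma ((n + 1) / 2) := by
    have hq := hG (n : ℝ) (by linarith [(Nat.cast_nonneg n : (0 : ℝ) ≤ _)])
    rw [← hq]
    refine setIntegral_congr_fun measurableSet_Ioi fun y _ => ?_
    obtain ⟨k, rfl⟩ : ∃ k, n = k + 1 := ⟨n - 1, by omega⟩
    simp only [Real.rpow_natCast, add_tsub_cancel_right, Real.rpow_two]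
    ring
  -- Total mass one fixes `c`, which is then eliminated from the mean norm.
  have e1 := hc fun _ => 1
  have e2 := hc fun y => y
  simp only [finrank_euclideanSpace, Fintype.card_fin] at e1 e2
  rw [h1] at e1
  rw [h2] at e2
  have hpow : ((1 : ℝ) / 2) ^ (-((n : ℝ) + 1) / 2) = (1 / 2) ^ (-(n : ℝ) / 2) * √2 := by
    rw [show -((n : ℝ) + 1) / 2 = -(n : ℝ) / 2 + -(1 / 2) by ring,
      Real.rpow_add (by norm_num), Real.rpow_neg (by norm_num), ← Real.sqrt_eq_rpow]
    simp
  have hg : Real.Gamma (n / 2) ≠ 0 := (Real.Gamma_pos_of_pos (by positivity)).ne'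
  simp only [integral_const, probReal_univ, smul_eq_mul, mul_one] at e1
  rw [e2, hpow, mul_div_assoc' √2, eq_div_iff hg]
  linear_combination (-√2 * Real.Gamma ((n + 1) / 2)) * e1

open MeasureTheory ProbabilityTheory in
lemma integrable_norm_stdGaussian (E : Type*) [NormedAddCommGroup E] [InnerProductSpace ℝ E]
    [FiniteDimensional ℝ E] [MeasurableSpace E] [BorelSpace E] :
    Integrable (fun x : E => ‖x‖) (stdGaussian E) :=
  (IsGaussian.integrable_id (μ := stdGaussian E)).norm

/-! ### Mean norm of a linear image of a Gaussian vector. -/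

lemma norm_sum_smul_le {n m : ℕ} (w : Fin n → EuclideanSpace ℝ (Fin m))
    (x : EuclideanSpace ℝ (Fin n)) : ‖∑ k, x k • w k‖ ≤ √(∑ k, ‖w k‖ ^ 2) * ‖x‖ := by
  refine (norm_sum_le _ _).trans ?_
  simp only [norm_smul]
  rw [EuclideanSpace.norm_eq, mul_comm]
  exact Real.sum_mul_le_sqrt_mul_sqrt _ _ _

-- A map and its transpose have the same mean norm: `|⟨W x, h⟩|` is integrated over independent
-- Gaussians in both orders, and the common factor `E|t|` cancels.
open MeasureTheory ProbabilityTheory in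
lemma integral_norm_apply_stdGaussian_eq {n m : ℕ} (w : Fin n → EuclideanSpace ℝ (Fin m)) :
    ∫ x : EuclideanSpace ℝ (Fin n), ‖∑ k, x k • w k‖ ∂(stdGaussian _) =
      ∫ h : EuclideanSpace ℝ (Fin m), √(∑ k, inner ℝ (w k) h ^ 2) ∂(stdGaussian _) := by
  have hswap := integral_integral_swap (μ := stdGaussian (EuclideanSpace ℝ (Fin n)))
    (ν := stdGaussian (EuclideanSpace ℝ (Fin m)))
    (f := fun x h => |inner ℝ (∑ k, x k • w k) h|) ?_
  · have h1 : ∀ (x : EuclideanSpace ℝ (Fin n)) (h : EuclideanSpace ℝ (Fin m)),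
        inner ℝ (∑ k, x k • w k) h =
          inner ℝ (WithLp.toLp 2 fun k => inner ℝ (w k) h : EuclideanSpace ℝ (Fin n)) x := by
      intro x h
      simp [sum_inner, inner_smul_left, PiLp.inner_apply]
    conv_rhs at hswap => simp only [h1]
    simp only [integral_abs_inner_stdGaussian, integral_mul_const] at hswap
    rw [mul_left_inj' integral_abs_gaussianReal_pos.ne'] at hswap
    rw [hswap]
    simp [EuclideanSpace.norm_eq]
  · refine ((integrable_norm_stdGaussian (EuclideanSpace ℝ (Fin n))).mul_prod
      ((integrable_norm_stdGaussian (EuclideanSpace ℝ (Fin m))).const_mul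
        √(∑ k, ‖w k‖ ^ 2))).mono' ?_ (Filter.Eventually.of_forall fun z => ?_)
    · refine Continuous.aestronglyMeasurable ?_
      simp only [Function.uncurry_def]
      fun_prop
    · simp only [Function.uncurry_def, Real.norm_eq_abs, abs_abs]
      refine (abs_real_inner_le_norm _ _).trans ?_
      refine (mul_le_mul_of_nonneg_right (norm_sum_smul_le w z.1) (norm_nonneg _)).trans ?_
      exact le_of_eq (by ring)

open MeasureTheory ProbabilityTheory in
lemma integrable_inner_sq_div_norm_stdGaussian {E : Type*} [NormedAddCommGroup E]
    [InnerProductSpace ℝ E] [FiniteDimensional ℝ E] [MeasurableSpace E] [BorelSpace E] (v : E) :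
    Integrable (fun h => inner ℝ v h ^ 2 / ‖h‖) (stdGaussian E) := by
  refine ((integrable_norm_stdGaussian E).const_mul (‖v‖ ^ 2)).mono'
    (Measurable.aestronglyMeasurable (by fun_prop)) (Filter.Eventually.of_forall fun h => ?_)
  rw [Real.norm_of_nonneg (by positivity)]
  refine div_le_of_le_mul₀ (norm_nonneg _) (by positivity) ?_
  have := pow_le_pow_left₀ (abs_nonneg _) (abs_real_inner_le_norm v h) 2
  rw [sq_abs] at this
  exact this.trans (le_of_eq (by ring))

-- The reflection exchanging `v` and `w` preserves the Gaussian measure.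
open MeasureTheory ProbabilityTheory in
lemma integral_inner_sq_div_norm_stdGaussian_congr {E : Type*} [NormedAddCommGroup E]
    [InnerProductSpace ℝ E] [FiniteDimensional ℝ E] [MeasurableSpace E] [BorelSpace E]
    {v w : E} (hvw : ‖v‖ = ‖w‖) :
    ∫ h, inner ℝ v h ^ 2 / ‖h‖ ∂(stdGaussian E) =
      ∫ h, inner ℝ w h ^ 2 / ‖h‖ ∂(stdGaussian E) := by
  let R := (Submodule.span ℝ {v - w})ᗮ.reflection
  have hR : R v = w := Submodule.reflection_sub hvw
  conv_rhs => rw [← stdGaussian_map R]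
  rw [integral_map R.continuous.aemeasurable (Measurable.aestronglyMeasurable (by fun_prop))]
  simp only [← hR, LinearIsometryEquiv.inner_map_map, LinearIsometryEquiv.norm_map]

-- By symmetry `v` may point along any coordinate axis; summing over all `m` axes turns the
-- integrand into `‖v‖² ‖h‖`.
open MeasureTheory ProbabilityTheory in
lemma integral_inner_sq_div_norm_stdGaussian {m : ℕ} (hm : 0 < m)
    (v : EuclideanSpace ℝ (Fin m)) :
    ∫ h, inner ℝ v h ^ 2 / ‖h‖ ∂(stdGaussian (EuclideanSpace ℝ (Fin m))) =
      ‖v‖ ^ 2 / m * ∫ h, ‖h‖ ∂(stdGaussian (EuclideanSpace ℝ (Fin m))) := by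
  have h1 : ∀ i : Fin m, ∫ h, inner ℝ v h ^ 2 / ‖h‖ ∂(stdGaussian (EuclideanSpace ℝ (Fin m))) =
      ∫ h, inner ℝ (EuclideanSpace.single i ‖v‖ : EuclideanSpace ℝ (Fin m)) h ^ 2 / ‖h‖
        ∂(stdGaussian (EuclideanSpace ℝ (Fin m))) :=
    fun i => integral_inner_sq_div_norm_stdGaussian_congr (by simp)
  have h2 : (m : ℝ) * ∫ h, inner ℝ v h ^ 2 / ‖h‖ ∂(stdGaussian (EuclideanSpace ℝ (Fin m))) =
      ‖v‖ ^ 2 * ∫ h, ‖h‖ ∂(stdGaussian (EuclideanSpace ℝ (Fin m))) := by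
    calc _ = ∑ i : Fin m, ∫ h, inner ℝ v h ^ 2 / ‖h‖
          ∂(stdGaussian (EuclideanSpace ℝ (Fin m))) := by simp
      _ = ∑ i : Fin m, ∫ h, inner ℝ (EuclideanSpace.single i ‖v‖ : EuclideanSpace ℝ (Fin m)) h ^ 2
          / ‖h‖ ∂(stdGaussian (EuclideanSpace ℝ (Fin m))) := Finset.sum_congr rfl fun i _ => h1 i
      _ = ∫ h, ∑ i : Fin m, inner ℝ (EuclideanSpace.single i ‖v‖ : EuclideanSpace ℝ (Fin m)) h ^ 2
          / ‖h‖ ∂(stdGaussian (EuclideanSpace ℝ (Fin m))) :=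
        (integral_finsetSum _ fun i _ => integrable_inner_sq_div_norm_stdGaussian _).symm
      _ = _ := by
        rw [← integral_const_mul]
        congr 1
        ext h
        have : ∑ i, h i ^ 2 = ‖h‖ ^ 2 := (EuclideanSpace.real_norm_sq_eq h).symm
        simp only [EuclideanSpace.inner_single_left, conj_trivial, mul_pow]
        rw [← Finset.sum_div, ← Finset.mul_sum, this, mul_div_assoc, sq ‖h‖, mul_self_div_self]
  have : (m : ℝ) ≠ 0 := by positivity
  field_simp
  linarith

open MeasureTheory ProbabilityTheory in
lemma integral_sum_inner_sq_div_norm_stdGaussian {n m : ℕ} (hm : 0 < m)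
    (w : Fin n → EuclideanSpace ℝ (Fin m)) :
    ∫ h, ∑ k, inner ℝ (w k) h ^ 2 / ‖h‖ ∂(stdGaussian (EuclideanSpace ℝ (Fin m))) =
      (∑ k, ‖w k‖ ^ 2) / m * ∫ h, ‖h‖ ∂(stdGaussian (EuclideanSpace ℝ (Fin m))) := by
  rw [integral_finsetSum _ fun k _ => integrable_inner_sq_div_norm_stdGaussian (w k)]
  simp only [integral_inner_sq_div_norm_stdGaussian hm]
  rw [← Finset.sum_mul, ← Finset.sum_div]

/-- AM–GM for `c * t` and `S / (c * t)`. -/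
lemma sqrt_le_half_add_div {c t S : ℝ} (hc : 0 < c) (ht : 0 < t) (hS : 0 ≤ S) :
    √S ≤ (c * t + c⁻¹ * (S / t)) / 2 := by
  obtain ⟨s, hs, rfl⟩ : ∃ s : ℝ, 0 ≤ s ∧ S = s ^ 2 := ⟨√S, Real.sqrt_nonneg S, by simp [hS]⟩
  have h : (c * t + c⁻¹ * (s ^ 2 / t)) / 2 - s = (c * t - s) ^ 2 / (2 * (c * t)) := by
    field_simp
    ring
  have h' : 0 ≤ (c * t - s) ^ 2 / (2 * (c * t)) := by positivity
  rw [Real.sqrt_sq hs]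
  linarith

open MeasureTheory ProbabilityTheory in
/-- Among linear maps of a given Hilbert–Schmidt norm into `ℝ^m`, the expected norm of the image of
a standard Gaussian vector is largest for multiples of coisometries. -/
lemma integral_norm_apply_stdGaussian_le {n m : ℕ} (hm : 0 < m)
    (w : Fin n → EuclideanSpace ℝ (Fin m)) :
    ∫ x : EuclideanSpace ℝ (Fin n), ‖∑ k, x k • w k‖ ∂(stdGaussian _) ≤
      (∫ h, ‖h‖ ∂(stdGaussian (EuclideanSpace ℝ (Fin m)))) / √m * √(∑ k, ‖w k‖ ^ 2) := by
  rcases (Finset.sum_nonneg fun k _ => sq_nonneg ‖w k‖ :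
    0 ≤ ∑ k, ‖w k‖ ^ 2).eq_or_lt with h0 | hpos
  · have hw : ∀ k, w k = 0 := by
      intro k
      have := (Finset.sum_eq_zero_iff_of_nonneg fun k _ => sq_nonneg ‖w k‖).mp h0.symm k
        (Finset.mem_univ k)
      simpa using this
    simp [hw]
  set F := ∑ k, ‖w k‖ ^ 2 with hF
  -- This `c` gives the two AM–GM terms equal expectation.
  obtain ⟨c, hc⟩ : ∃ c, c = √F / √m := ⟨_, rfl⟩
  have hm' : (0 : ℝ) < m := by positivity
  have hc0 : 0 < c := by rw [hc]; positivity
  have hc2 : c ^ 2 = F / m := by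
    rw [hc, div_pow, Real.sq_sqrt hpos.le, Real.sq_sqrt hm'.le]
  rw [integral_norm_apply_stdGaussian_eq]
  have hint1 := (integrable_norm_stdGaussian (EuclideanSpace ℝ (Fin m))).const_mul c
  have hint2 := (integrable_finsetSum Finset.univ fun k _ =>
    integrable_inner_sq_div_norm_stdGaussian (w k)).const_mul c⁻¹
  have hle : ∀ h : EuclideanSpace ℝ (Fin m), √(∑ k, inner ℝ (w k) h ^ 2) ≤
      (c * ‖h‖ + c⁻¹ * ∑ k, inner ℝ (w k) h ^ 2 / ‖h‖) / 2 := by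
    intro h
    rcases eq_or_ne h 0 with rfl | hh
    · simp
    have hh' : 0 < ‖h‖ := norm_pos_iff.mpr hh
    rw [← Finset.sum_div]
    exact sqrt_le_half_add_div hc0 hh' (Finset.sum_nonneg fun k _ => sq_nonneg _)
  refine (integral_mono_of_nonneg (Filter.Eventually.of_forall fun h => Real.sqrt_nonneg _)
    ((hint1.add hint2).div_const 2) (Filter.Eventually.of_forall hle)).trans (le_of_eq ?_)
  simp only [Pi.add_apply]
  rw [integral_div, integral_add hint1 hint2, integral_const_mul, integral_const_mul,
    integral_sum_inner_sq_div_norm_stdGaussian hm, ← hF, ← hc2]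
  generalize ∫ h, ‖h‖ ∂(stdGaussian (EuclideanSpace ℝ (Fin m))) = l
  rw [show l / √m * √F = c * l by rw [hc]; ring]
  field_simp
  ring

/-! ### Bounds for the Gamma ratio and the asymptotic expansion. -/

/-- The ratio `Γ((k+1)/2) / Γ(k/2)`. -/
noncomputable def gammaHalfRatio (k : ℕ) : ℝ :=
  Real.Gamma (((k : ℝ) + 1) / 2) / Real.Gamma ((k : ℝ) / 2)

lemma gammaHalfRatio_pos {k : ℕ} (hk : 0 < k) : 0 < gammaHalfRatio k :=
  div_pos (Real.Gamma_pos_of_pos (by positivity)) (Real.Gamma_pos_of_pos (by positivity))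

lemma gammaHalfRatio_mul_succ {k : ℕ} (hk : 0 < k) :
    gammaHalfRatio k * gammaHalfRatio (k + 1) = k / 2 := by
  have hk' : (k : ℝ) / 2 ≠ 0 := by positivity
  have h1 : Real.Gamma ((k : ℝ) / 2) ≠ 0 := (Real.Gamma_pos_of_pos (by positivity)).ne'
  have h2 : Real.Gamma (((k : ℝ) + 1) / 2) ≠ 0 := (Real.Gamma_pos_of_pos (by positivity)).ne'
  have h3 := Real.Gamma_add_one hk'
  unfold gammaHalfRatio
  push_cast
  rw [show ((k : ℝ) + 1 + 1) / 2 = k / 2 + 1 by ring, h3]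
  field_simp

/-- Log-convexity of `Γ` at the midpoint of `k/2` and `k/2 + 1`. -/
lemma gammaHalfRatio_le_succ {k : ℕ} (hk : 0 < k) :
    gammaHalfRatio k ≤ gammaHalfRatio (k + 1) := by
  have h1 : 0 < Real.Gamma ((k : ℝ) / 2) := Real.Gamma_pos_of_pos (by positivity)
  have h2 : 0 < Real.Gamma (((k : ℝ) + 1) / 2) := Real.Gamma_pos_of_pos (by positivity)
  have h3 : 0 < Real.Gamma (((k : ℝ) + 1 + 1) / 2) := Real.Gamma_pos_of_pos (by positivity)
  have h := Real.Gamma_mul_add_mul_le_rpow_Gamma_mul_rpow_Gamma (s := (k : ℝ) / 2)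
    (t := ((k : ℝ) + 1 + 1) / 2) (a := 1 / 2) (b := 1 / 2) (by positivity) (by positivity)
    (by norm_num) (by norm_num) (by norm_num)
  rw [show (1 : ℝ) / 2 * (k / 2) + 1 / 2 * (((k : ℝ) + 1 + 1) / 2) = ((k : ℝ) + 1) / 2 by ring,
    ← Real.sqrt_eq_rpow, ← Real.sqrt_eq_rpow, ← Real.sqrt_mul h1.le] at h
  have h4 := (Real.le_sqrt' h2).mp h
  unfold gammaHalfRatio
  push_cast
  rw [div_le_div_iff₀ h1 h2]
  linarith

lemma le_gammaHalfRatio_succ_sq {k : ℕ} (hk : 0 < k) :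
    (k : ℝ) / 2 ≤ gammaHalfRatio (k + 1) ^ 2 := by
  rw [← gammaHalfRatio_mul_succ hk, sq]
  exact mul_le_mul_of_nonneg_right (gammaHalfRatio_le_succ hk) (gammaHalfRatio_pos k.succ_pos).le

lemma gammaHalfRatio_add_two {k : ℕ} (hk : 0 < k) :
    gammaHalfRatio (k + 2) = gammaHalfRatio k * ((k + 1) / k) := by
  have h1 := gammaHalfRatio_mul_succ hk
  have h2 := gammaHalfRatio_mul_succ k.succ_pos
  have h3 := gammaHalfRatio_pos k.succ_pos
  rw [← mul_right_inj' h3.ne']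
  have hk' : (k : ℝ) ≠ 0 := by positivity
  rw [show k + 2 = k + 1 + 1 by rfl, show k.succ = k + 1 by rfl] at *
  rw [h2]
  push_cast
  field_simp
  linear_combination -2 * h1

-- The quotient of the two sides decreases along steps of two, while the cruder bound
-- `le_gammaHalfRatio_succ_sq` keeps its limit at least 1; so it is at least 1 from the start.
open Filter Topology in
lemma le_gammaHalfRatio_sq {k : ℕ} (hk : 0 < k) :
    (k : ℝ) / 2 - 1 / 4 ≤ gammaHalfRatio k ^ 2 := by
  let f : ℕ → ℝ := fun j =>
    gammaHalfRatio (k + 2 * j) ^ 2 / (((k + 2 * j : ℕ) : ℝ) / 2 - 1 / 4)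
  have hpos : ∀ l : ℕ, 0 < l → (0 : ℝ) < (l : ℝ) / 2 - 1 / 4 := fun l hl => by
    have : (1 : ℝ) ≤ l := by exact_mod_cast hl
    linarith
  have hanti : Antitone f := by
    refine antitone_nat_of_succ_le fun j => ?_
    simp only [f]
    generalize hl : k + 2 * j = l
    have hl0 : 0 < l := by omega
    rw [show k + 2 * (j + 1) = l + 2 by omega, gammaHalfRatio_add_two hl0,
      div_le_div_iff₀ (hpos _ (by omega)) (hpos _ hl0)]
    have hl1 : (0 : ℝ) < l := by exact_mod_cast hl0
    -- With denominators cleared, the sides differ by exactly `1/4`.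
    have key : (((l : ℝ) + 1) / l) ^ 2 * ((l : ℝ) / 2 - 1 / 4) ≤ ((l + 2 : ℕ) : ℝ) / 2 - 1 / 4 := by
      push_cast
      rw [div_pow, div_mul_eq_mul_div, div_le_iff₀ (by positivity)]
      nlinarith
    have := mul_le_mul_of_nonneg_left key (sq_nonneg (gammaHalfRatio l))
    linarith [mul_pow (gammaHalfRatio l) (((l : ℝ) + 1) / l) 2]
  have hge : ∀ j : ℕ, 1 - 1 / ((j : ℝ) + 1) ≤ f (j + 1) := by
    intro j
    simp only [f]
    have h1 := le_gammaHalfRatio_succ_sq (k := k + 2 * (j + 1) - 1) (by omega)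
    rw [show k + 2 * (j + 1) - 1 + 1 = k + 2 * (j + 1) by omega,
      Nat.cast_sub (by omega)] at h1
    rw [le_div_iff₀ (hpos _ (by omega))]
    refine le_trans ?_ h1
    push_cast
    have hk1 : (1 : ℝ) ≤ k := by exact_mod_cast hk
    have hj : (0 : ℝ) ≤ j := j.cast_nonneg
    rw [one_sub_div (by positivity), div_mul_eq_mul_div, div_le_iff₀ (by positivity)]
    nlinarith
  have hlim : Tendsto (fun j : ℕ => 1 - 1 / ((j : ℝ) + 1)) atTop (𝓝 (1 - 0)) :=
    tendsto_const_nhds.sub tendsto_one_div_add_atTop_nhds_zero_nat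
  have h0 : 1 - 0 ≤ f 0 := le_of_tendsto' hlim fun j => (hge j).trans (hanti (Nat.zero_le _))
  simp only [f, mul_zero, add_zero, sub_zero] at h0
  rwa [le_div_iff₀ (hpos k hk), one_mul] at h0

/-- The lower bound at `k + 1` becomes an upper bound at `k` through `gammaHalfRatio_mul_succ`. -/
lemma gammaHalfRatio_sq_le_sq_div {k : ℕ} (hk : 0 < k) :
    gammaHalfRatio k ^ 2 ≤ (k : ℝ) ^ 2 / (2 * k + 1) := by
  have h1 := le_gammaHalfRatio_sq k.succ_pos
  have h2 := congrArg (· ^ 2) (gammaHalfRatio_mul_succ hk)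
  simp only [mul_pow, Nat.succ_eq_add_one] at h1 h2
  rw [le_div_iff₀ (by positivity)]
  push_cast at h1
  nlinarith [mul_le_mul_of_nonneg_left h1 (sq_nonneg (gammaHalfRatio k))]

lemma abs_gamma_ratio_sub_le {m n : ℕ} (hm : 0 < m) (hmn : m < n) :
    |(m : ℝ) / (n : ℝ) *
        (Real.Gamma ((m : ℝ) / 2) / Real.Gamma (((m : ℝ) + 1) / 2) *
          (Real.Gamma (((n : ℝ) + 1) / 2) / Real.Gamma ((n : ℝ) / 2))) ^ 2
      - (1 + 1 / (2 * (m : ℝ)) - 1 / (2 * (n : ℝ)))| ≤ 2 / (m : ℝ) ^ 2 := by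
  have hn : 0 < n := hm.trans hmn
  have hm' : (0 : ℝ) < m := by exact_mod_cast hm
  have hn' : (0 : ℝ) < n := by exact_mod_cast hn
  have hexpr : (m : ℝ) / (n : ℝ) *
        (Real.Gamma ((m : ℝ) / 2) / Real.Gamma (((m : ℝ) + 1) / 2) *
          (Real.Gamma (((n : ℝ) + 1) / 2) / Real.Gamma ((n : ℝ) / 2))) ^ 2 =
      (gammaHalfRatio n ^ 2 / (n / 2)) / (gammaHalfRatio m ^ 2 / (m / 2)) := by
    rw [← inv_div (Real.Gamma (((m : ℝ) + 1) / 2))]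
    change (m : ℝ) / n * ((gammaHalfRatio m)⁻¹ * gammaHalfRatio n) ^ 2 = _
    have := (gammaHalfRatio_pos hm).ne'
    field_simp
  rw [hexpr]
  have lower : ∀ k : ℕ, 0 < k → 1 - 1 / (2 * (k : ℝ)) ≤ gammaHalfRatio k ^ 2 / (k / 2) := by
    intro k hk
    have hk' : (0 : ℝ) < k := by exact_mod_cast hk
    rw [le_div_iff₀ (by positivity)]
    refine le_trans (le_of_eq ?_) (le_gammaHalfRatio_sq hk)
    field_simp
    ring
  have upper : ∀ k : ℕ, 0 < k → gammaHalfRatio k ^ 2 / (k / 2) ≤ 1 / (1 + 1 / (2 * (k : ℝ))) := by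
    intro k hk
    have hk' : (0 : ℝ) < k := by exact_mod_cast hk
    rw [div_le_iff₀ (by positivity)]
    refine (gammaHalfRatio_sq_le_sq_div hk).trans (le_of_eq ?_)
    field_simp
  have hy : 1 / (2 * (m : ℝ)) ≤ 1 / 2 := by
    have : (1 : ℝ) ≤ m := by exact_mod_cast hm
    exact one_div_le_one_div_of_le two_pos (by linarith)
  have hxy : 1 / (2 * (n : ℝ)) ≤ 1 / (2 * (m : ℝ)) := by
    have : (m : ℝ) ≤ n := by exact_mod_cast hmn.le
    exact one_div_le_one_div_of_le (by positivity) (by linarith)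
  -- With `x = 1/(2n)` and `y = 1/(2m)`, the quotient lies between `(1 - x)(1 + y)` and `1 / ((1 +
  -- x)(1 - y))`; as `0 < x ≤ y ≤ 1/2`, an error of `8 y²` suffices.
  have hC : (2 : ℝ) / m ^ 2 = 8 * (1 / (2 * (m : ℝ))) ^ 2 := by field_simp; norm_num
  have ln := lower n hn
  have un := upper n hn
  have lm := lower m hm
  have um := upper m hm
  have hx0 : 0 < 1 / (2 * (n : ℝ)) := by positivity
  rw [hC]
  generalize 1 / (2 * (n : ℝ)) = x at *
  generalize 1 / (2 * (m : ℝ)) = y at *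
  generalize gammaHalfRatio n ^ 2 / (n / 2) = a at *
  generalize gammaHalfRatio m ^ 2 / (m / 2) = b at *
  have hb : 0 < b := by linarith
  have ha : 0 < a := by linarith
  rw [le_div_iff₀ (by linarith)] at un um
  rw [abs_le]
  constructor
  · have h1 : (1 - x) * (1 + y) ≤ a / b := by
      rw [le_div_iff₀ hb]
      nlinarith
    nlinarith
  · have h1 : a / b ≤ 1 / ((1 + x) * (1 - y)) := by
      rw [div_le_div_iff₀ hb (by nlinarith)]
      nlinarith
    have h2 : 1 / ((1 + x) * (1 - y)) ≤ 1 + y - x + 8 * y ^ 2 := by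
      rw [div_le_iff₀ (by nlinarith)]
      have hy0 : 0 ≤ y := by linarith
      have hyx : 0 ≤ y - x := by linarith
      have hy2 : 0 ≤ 1 / 2 - y := by linarith
      nlinarith [mul_nonneg hx0.le hy0, mul_nonneg hyx hy0, mul_nonneg hx0.le hyx,
        mul_nonneg (sq_nonneg y) hy2, mul_nonneg (mul_nonneg (sq_nonneg y) hx0.le) hy2]
    linarith

/-! ### Discretising the Gaussian and conclusion. -/

-- The image measure of a simple function is a finite sum of weighted atoms, the data that
-- `sq_sum_mul_norm_div_le` takes.
open MeasureTheory ProbabilityTheory in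
lemma SimpleFunc.exists_weights {α E : Type*} [MeasurableSpace α] [NormedAddCommGroup E]
    [Nonempty α] (μ : Measure α) [IsFiniteMeasure μ] (g : SimpleFunc α E) :
    ∃ r : ℕ, 0 < r ∧ ∃ p : Fin r → ℝ, (∀ i, 0 ≤ p i) ∧ ∃ x : Fin r → E,
      ∀ f : E → ℝ, f 0 = 0 → ∑ i, p i * f (x i) = ∫ a, f (g a) ∂μ := by
  refine ⟨g.range.card, Finset.card_pos.mpr ⟨_, g.mem_range_self (Classical.arbitrary α)⟩,
    fun i => μ.real (g ⁻¹' {(g.range.equivFin.symm i : E)}), fun i => measureReal_nonneg,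
    fun i => g.range.equivFin.symm i, fun f hf => ?_⟩
  have h1 : ∫ a, f (g a) ∂μ = ∫ a, (g.map f) a ∂μ := rfl
  have hint : Integrable g μ := g.integrable_of_isFiniteMeasure
  rw [h1, ← SimpleFunc.integral_eq_integral _ (SimpleFunc.integrable_of_isFiniteMeasure _),
    SimpleFunc.map_integral g f hint hf, ← Finset.sum_coe_sort g.range]
  exact g.range.equivFin.symm.sum_comp fun y => μ.real (g ⁻¹' {(y : E)}) * f y

open MeasureTheory ProbabilityTheory in
/-- The Grothendieck inequality tested on a Gaussian average. -/
lemma sq_integral_norm_sub_div_le {m n : ℕ} (hm : 0 < m) (hn : 0 < n) {K : ℝ}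
    (hK : K ∈ grothendieckBounds n m) {ε : ℝ} (hε : 0 < ε) :
    max 0 ((∫ x, ‖x‖ ∂(stdGaussian (EuclideanSpace ℝ (Fin n)))) - ε) ^ 2 / n ≤
      K * ((∫ x, ‖x‖ ∂(stdGaussian (EuclideanSpace ℝ (Fin m)))) / √m + ε) ^ 2 := by
  set μ := stdGaussian (EuclideanSpace ℝ (Fin n))
  obtain ⟨g, hg, -⟩ := (memLp_one_iff_integrable.mpr
    (IsGaussian.integrable_id (μ := μ))).exists_simpleFunc_eLpNorm_sub_lt (by simp)
    (ε := ENNReal.ofReal ε) (by simpa using hε)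
  have hid : Integrable (fun x : EuclideanSpace ℝ (Fin n) => x) μ := IsGaussian.integrable_id
  have hgi : Integrable g μ := g.integrable_of_isFiniteMeasure
  have hd : Integrable (fun x => ‖x - g x‖) μ := (hid.sub hgi).norm
  have hgε : ∫ x, ‖x - g x‖ ∂μ ≤ ε := by
    rw [eLpNorm_one_eq_lintegral_enorm] at hg
    rw [integral_norm_eq_lintegral_enorm (f := fun x => x - g x)
      (hid.sub hgi).aestronglyMeasurable]
    exact ENNReal.toReal_le_of_le_ofReal hε.le hg.le
  obtain ⟨r, hr, p, hp, x, hx⟩ := SimpleFunc.exists_weights μ g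
  have hmain := sq_sum_mul_norm_div_le hm hn hr hK p hp x
    (B := (∫ x, ‖x‖ ∂(stdGaussian (EuclideanSpace ℝ (Fin m)))) / √m + ε) ?_
  · refine le_trans ?_ hmain
    rw [hx _ norm_zero]
    have h1 : ∫ x, ‖x‖ ∂μ ≤ ∫ x, ‖g x‖ ∂μ + ∫ x, ‖x - g x‖ ∂μ := by
      rw [← integral_add hgi.norm hd]
      exact integral_mono hid.norm (hgi.norm.add hd) fun x => norm_le_norm_add_norm_sub' _ _
    -- Truncation at 0 keeps the base nonnegative, so that squaring is monotone.
    have h2 : max 0 ((∫ x, ‖x‖ ∂μ) - ε) ≤ ∫ x, ‖g x‖ ∂μ :=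
      max_le (integral_nonneg fun x => norm_nonneg _) (by linarith)
    exact div_le_div_of_nonneg_right (pow_le_pow_left₀ (le_max_left _ _) h2 2) (by positivity)
  · intro w
    rw [hx (fun y => ‖∑ k, y k • w k‖) (by simp)]
    have hT : Integrable (fun x : EuclideanSpace ℝ (Fin n) => ‖∑ k, x k • w k‖) μ :=
      (hid.norm.const_mul √(∑ k, ‖w k‖ ^ 2)).mono'
        (Continuous.aestronglyMeasurable (by fun_prop))
        (Filter.Eventually.of_forall fun x => by
          rw [norm_norm]
          exact norm_sum_smul_le w x)
    -- The map is Lipschitz with constant its Hilbert–Schmidt norm, so the `L¹` error costs only `ε`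
    -- in `B`, uniformly in `w`.
    have h1 : ∫ x, ‖∑ k, g x k • w k‖ ∂μ ≤
        ∫ x, (‖∑ k, x k • w k‖ + √(∑ k, ‖w k‖ ^ 2) * ‖x - g x‖) ∂μ := by
      refine integral_mono_of_nonneg (Filter.Eventually.of_forall fun x => norm_nonneg _)
        (hT.add (hd.const_mul _)) (Filter.Eventually.of_forall fun x => ?_)
      have h2 := norm_sum_smul_le w (x - g x)
      have h3 : ∑ k, (x - g x) k • w k = ∑ k, x k • w k - ∑ k, g x k • w k := by
        simp [sub_smul]
      rw [h3] at h2
      exact (norm_le_norm_add_norm_sub (∑ k, x k • w k) _).trans (add_le_add le_rfl h2)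
    rw [integral_add hT (hd.const_mul _), integral_const_mul] at h1
    have h4 := integral_norm_apply_stdGaussian_le hm w
    have h5 := mul_le_mul_of_nonneg_left hgε (Real.sqrt_nonneg (∑ k, ‖w k‖ ^ 2))
    rw [add_mul]
    linarith

open MeasureTheory ProbabilityTheory Filter Topology in
lemma sq_integral_norm_div_le {m n : ℕ} (hm : 0 < m) (hn : 0 < n) {K : ℝ}
    (hK : K ∈ grothendieckBounds n m) :
    (∫ x, ‖x‖ ∂(stdGaussian (EuclideanSpace ℝ (Fin n)))) ^ 2 / n ≤
      K * ((∫ x, ‖x‖ ∂(stdGaussian (EuclideanSpace ℝ (Fin m)))) / √m) ^ 2 := by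
  set a := ∫ x, ‖x‖ ∂(stdGaussian (EuclideanSpace ℝ (Fin n)))
  set b := (∫ x, ‖x‖ ∂(stdGaussian (EuclideanSpace ℝ (Fin m)))) / √m
  have ha : 0 ≤ a := integral_nonneg fun x => norm_nonneg _
  have h1 : Tendsto (fun ε : ℝ => max 0 (a - ε) ^ 2 / n) (𝓝[>] 0) (𝓝 (a ^ 2 / n)) := by
    have : Continuous fun ε : ℝ => max 0 (a - ε) ^ 2 / n := by fun_prop
    simpa [ha] using (this.tendsto 0).mono_left nhdsWithin_le_nhds
  have h2 : Tendsto (fun ε : ℝ => K * (b + ε) ^ 2) (𝓝[>] 0) (𝓝 (K * b ^ 2)) := by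
    have : Continuous fun ε : ℝ => K * (b + ε) ^ 2 := by fun_prop
    simpa using (this.tendsto 0).mono_left nhdsWithin_le_nhds
  refine le_of_tendsto_of_tendsto h1 h2 ?_
  filter_upwards [self_mem_nhdsWithin] with ε hε
  exact sq_integral_norm_sub_div_le hm hn hK hε

lemma gamma_ratio_le_of_mem_grothendieckBounds {m n : ℕ} (hm : 0 < m) (hn : 0 < n) {K : ℝ}
    (hK : K ∈ grothendieckBounds n m) :
    (m : ℝ) / (n : ℝ) *
        (Real.Gamma ((m : ℝ) / 2) / Real.Gamma (((m : ℝ) + 1) / 2) *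
          (Real.Gamma (((n : ℝ) + 1) / 2) / Real.Gamma ((n : ℝ) / 2))) ^ 2 ≤ K := by
  have h := sq_integral_norm_div_le hm hn hK
  rw [integral_norm_stdGaussian hm, integral_norm_stdGaussian hn] at h
  rw [← inv_div (Real.Gamma (((m : ℝ) + 1) / 2))]
  change (m : ℝ) / n * ((gammaHalfRatio m)⁻¹ * gammaHalfRatio n) ^ 2 ≤ K
  change (√2 * gammaHalfRatio n) ^ 2 / n ≤ K * (√2 * gammaHalfRatio m / √m) ^ 2 at h
  have hg := gammaHalfRatio_pos hm
  have hm' : (0 : ℝ) < m := by exact_mod_cast hm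
  have hn' : (0 : ℝ) < n := by exact_mod_cast hn
  rw [mul_pow, div_pow, mul_pow, Real.sq_sqrt two_pos.le, Real.sq_sqrt hm'.le, mul_div_assoc',
    div_le_div_iff₀ hn' hm'] at h
  rw [mul_pow, inv_pow, ← div_eq_inv_mul, div_mul_div_comm, div_le_iff₀ (by positivity)]
  linarith

theorem theorem1 :
    (∀ m n : ℕ, 0 < m → m < n →
      IsLeast (grothendieckBounds n m) (grothendieckConst n m) ∧
      (m : ℝ) / (n : ℝ) *
          (Real.Gamma ((m : ℝ) / 2) / Real.Gamma (((m : ℝ) + 1) / 2) *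
            (Real.Gamma (((n : ℝ) + 1) / 2) / Real.Gamma ((n : ℝ) / 2))) ^ 2
        ≤ grothendieckConst n m) ∧
    (∃ C : ℝ, ∀ m n : ℕ, 0 < m → m < n →
      |(m : ℝ) / (n : ℝ) *
          (Real.Gamma ((m : ℝ) / 2) / Real.Gamma (((m : ℝ) + 1) / 2) *
            (Real.Gamma (((n : ℝ) + 1) / 2) / Real.Gamma ((n : ℝ) / 2))) ^ 2
        - (1 + 1 / (2 * (m : ℝ)) - 1 / (2 * (n : ℝ)))| ≤ C / (m : ℝ) ^ 2) := by
  refine ⟨fun m n hm hmn => ?_, 2, fun m n hm hmn => abs_gamma_ratio_sub_le hm hmn⟩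
  have hleast := isLeast_grothendieckConst hm (hm.trans hmn)
  exact ⟨hleast, gamma_ratio_le_of_mem_grothendieckBounds hm (hm.trans hmn) hleast.1⟩
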